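/- Let $d\ge 1$ and consider $\mathbb{Z}^d$ as a graph in which $u,v$ are adjacent iff $\|u-v\|_1=1$. For a set $\Lambda\subset\mathbb{Z}^d$ let $\partial_\circ\Lambda$ be the set of vertices outside $\Lambda$ that are adjacent to a vertex of $\Lambda$, and let $\Lambda^+=\Lambda\cup\partial_\circ\Lambda$. A homomorphism height function on $D\subset\mathbb{Z}^d$ is a function $f:D\to\mathbb{Z}$ with $|f(u)-f(v)|\le\|u-v\|_1$ and $f(v)\equiv\|v\|_1 \pmod 2$ for all $u,v\in D$. For non-empty, finite $\Lambda$ and a homomorphism height function $\tau$ on $\partial_\circ\Lambda$, let $\mu^{\Lambda,\tau}$ be the uniform probability measure on the homomorphism height functions on $\Lambda^+$ that equal $\tau$ on $\partial_\circ\Lambda$. A Gibbs measure for homomorphism pairs is a probability measure $\rho$ on pairs $(f,g)$ of homomorphism height functions on $\mathbb{Z}^d$ such that, for every non-empty, finite $\Lambda\subset\mathbb{Z}^d$, the conditional distribution of $(f,g)|_{\Lambda^+}$ given $(f,g)|_{\Lambda^c}$ is $\rho$-almost surely the product measure $\mu^{\Lambda,\tau_f}\otimes\mu^{\Lambda,\tau_g}$,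 where $\tau_f=f|_{\partial_\circ\Lambda}$ and $\tau_g=g|_{\partial_\circ\Lambda}$. Let $(f,g)$ be sampled from a Gibbs measure for homomorphism pairs. (i) If $$\mathbb{P}\big(\text{there is an infinite connected component of }\{v\in\mathbb{Z}^d: f(v)<g(v)\}\big)=0,$$ then the distribution of $f$ stochastically dominates the distribution of $g$; that is, $\mathbb{E}\,\varphi(g)\le\mathbb{E}\,\varphi(f)$ for every bounded measurable $\varphi:\mathbb{Z}^{\mathbb{Z}^d}\to\mathbb{R}$ that is non-decreasing for the pointwise order. (ii) If $$\mathbb{P}\big(\text{there is an infinite connected component of }\{v\in\mathbb{Z}^d: f(v)\ne g(v)\}\big)=0,$$ then the distribution of $f$ equals the distribution of $g$. -/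

import Mathlib

open MeasureTheory ProbabilityTheory

noncomputable section

/-- The vertex set `ℤ^d`. -/
abbrev Zd (d : ℕ) : Type := Fin d → ℤ

/-- The `ℓ¹` norm on `ℤ^d`. -/
def l1norm {d : ℕ} (v : Zd d) : ℤ := ∑ i, |v i|

/-- The nearest-neighbour graph on `ℤ^d`: `u` and `v` are adjacent iff `‖u - v‖₁ = 1`. -/
def latticeGraph (d : ℕ) : SimpleGraph (Zd d) where
  Adj u v := l1norm (u - v) = 1
  symm := ⟨fun u v h => by simpa [l1norm, abs_sub_comm] using h⟩
  loopless := ⟨fun u h => by simp [l1norm] at h⟩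

/-- The external vertex boundary of `Λ`. -/
def extBoundary {d : ℕ} (Λ : Set (Zd d)) : Set (Zd d) :=
  {v | v ∉ Λ ∧ ∃ w ∈ Λ, (latticeGraph d).Adj w v}

/-- The 1-extension `Λ⁺ = Λ ∪ ∂Λ`. -/
def oneExt {d : ℕ} (Λ : Set (Zd d)) : Set (Zd d) := Λ ∪ extBoundary Λ

/-- A homomorphism height function on the domain `D ⊆ ℤ^d`: an integer-valued function that is
`1`-Lipschitz for the `ℓ¹` distance of `ℤ^d` and has the parity of the `ℓ¹` norm. -/
structure IsHeightFunction {d : ℕ} (D : Set (Zd d)) (f : D → ℤ) : Prop where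
  lipschitz : ∀ u v : D, |f u - f v| ≤ l1norm (u.1 - v.1)
  parity : ∀ v : D, f v ≡ l1norm v.1 [ZMOD 2]

/-- The homomorphism height functions on `Λ⁺` that agree with `τ` on the boundary of `Λ`. -/
def heightExtensions {d : ℕ} (Λ : Set (Zd d)) (τ : extBoundary Λ → ℤ) : Set (oneExt Λ → ℤ) :=
  {f | IsHeightFunction (oneExt Λ) f ∧
    ∀ v (hv : v ∈ extBoundary Λ), f ⟨v, Or.inr hv⟩ = τ ⟨v, hv⟩}

/-- The finite-volume Gibbs measure in `Λ` with boundary condition `τ`: the uniform measure on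
the homomorphism height functions on `Λ⁺` that agree with `τ` on the boundary of `Λ`. -/
def finiteGibbs {d : ℕ} (Λ : Set (Zd d)) (τ : extBoundary Λ → ℤ) : Measure (oneExt Λ → ℤ) :=
  uniformOn (heightExtensions Λ τ)

/-- Restriction of a pair of functions on `ℤ^d` to a subset `D`. -/
def restrictPair {d : ℕ} (D : Set (Zd d)) (p : (Zd d → ℤ) × (Zd d → ℤ)) :
    (D → ℤ) × (D → ℤ) :=
  (D.domRestrict p.1, D.domRestrict p.2)

/-- Gibbs measures for homomorphism pairs. The space `(ℤ²)^(ℤ^d)` is written as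
`ℤ^(ℤ^d) × ℤ^(ℤ^d)`, with points `p = (f, g)`. The measure is carried by pairs of homomorphism
height functions, and for each non-empty finite `Λ` the conditional distribution of
`(f, g)` restricted to `Λ⁺`, given `(f, g)` restricted to the complement of `Λ`, is almost surely
the product of the finite-volume Gibbs measures with boundary conditions `f` and `g`. -/
structure IsGibbsPair {d : ℕ} (ρ : Measure ((Zd d → ℤ) × (Zd d → ℤ)))
    [IsProbabilityMeasure ρ] : Prop where
  isHeightFunction : ∀ᵐ p ∂ρ, IsHeightFunction Set.univ (Set.univ.domRestrict p.1) ∧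
    IsHeightFunction Set.univ (Set.univ.domRestrict p.2)
  condDistrib_eq : ∀ Λ : Set (Zd d), Λ.Finite → Λ.Nonempty →
    ∀ᵐ p ∂ρ, condDistrib (restrictPair (oneExt Λ)) (restrictPair Λᶜ) ρ (restrictPair Λᶜ p) =
      (finiteGibbs Λ ((extBoundary Λ).domRestrict p.1)).prod
        (finiteGibbs Λ ((extBoundary Λ).domRestrict p.2))

/-- The subgraph of `ℤ^d` induced by `S` has an infinite connected component. -/
def HasInfiniteComponent {d : ℕ} (S : Set (Zd d)) : Prop :=
  ∃ C : ((latticeGraph d).induce S).ConnectedComponent, C.supp.Infinite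

/-- `μ` stochastically dominates `ν`, for the pointwise order on functions `ℤ^d → ℤ`: the integral
of every bounded, measurable, non-decreasing function is at least as large under `μ`. -/
def StochDominates {d : ℕ} (μ ν : Measure (Zd d → ℤ)) : Prop :=
  ∀ φ : (Zd d → ℤ) → ℝ, Measurable φ → Monotone φ → (∃ M : ℝ, ∀ f, |φ f| ≤ M) →
    ∫ f, φ f ∂ν ≤ ∫ f, φ f ∂μ

end

/-!
Swapping `f` and `g` on a finite region outside which they are insulated by a layer of equality
is a symmetry of Gibbs pairs, and the theorem follows from swapping as much as possible.

For `Λ ⊆ ℤ^d` let `U_Λ` be the union of all finite `C ⊆ Λ` such that `f = g` on the external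
boundary of `C` (`swapRegion`), and let `T_Λ` exchange `f` and `g` on `U_Λ` (`exchange`). Since
`f = g` on the boundary of `U_Λ`, the exchanged functions are again height functions, and since
`U_Λ` depends only on the set `{f = g}`, the map `T_Λ` is an involution. For finite `Λ` it leaves
`(f, g)` unchanged off `Λ`, so it permutes the pairs of height functions with given values off `Λ`;
these are equally likely by the Gibbs property, hence `T_Λ` preserves `ρ`
(`IsGibbsPair.map_exchange_of_finite`). Letting `Λ` increase to `ℤ^d`, `T = T_{ℤ^d}` preserves `ρ`
as well (`IsGibbsPair.map_exchange_univ`).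

Let `(f', g') = T (f, g)`, so that `f'` has the law of `f`. By parity, two height functions agree on
the boundary of every component of `{f < g}`, so if all these components are finite then
`{f < g} ⊆ U`, and therefore `f' ≥ g` everywhere: `f` dominates `g` in law. If all components of
`{f ≠ g}` are finite then `{f ≠ g} ⊆ U`, so `f' = g`, and `f` and `g` have the same law.
-/

open MeasureTheory ProbabilityTheory

noncomputable section

/-! ### Lattice geometry -/

lemma l1norm_nonneg {d : ℕ} (v : Zd d) : 0 ≤ l1norm v :=
  Finset.sum_nonneg fun _ _ => abs_nonneg _

lemma abs_le_l1norm {d : ℕ} (v : Zd d) (i : Fin d) : |v i| ≤ l1norm v :=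
  Finset.single_le_sum (f := fun i => |v i|) (fun _ _ => abs_nonneg _) (Finset.mem_univ i)

lemma Set.Finite.extBoundary {d : ℕ} {Λ : Set (Zd d)} (hΛ : Λ.Finite) :
    (extBoundary Λ).Finite := by
  refine (hΛ.biUnion fun w _ => Set.finite_Icc (w - 1) (w + 1)).subset ?_
  rintro v ⟨-, w, hw, hwv⟩
  refine Set.mem_biUnion hw ⟨fun i => ?_, fun i => ?_⟩
  all_goals
    have h : |w i - v i| ≤ 1 := (abs_le_l1norm (w - v) i).trans_eq hwv
    have := abs_le.mp h
    simp only [Pi.sub_apply, Pi.add_apply, Pi.one_apply]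
    omega

lemma Set.Finite.oneExt {d : ℕ} {Λ : Set (Zd d)} (hΛ : Λ.Finite) : (oneExt Λ).Finite :=
  hΛ.union hΛ.extBoundary

/-- The first step of a geodesic between two distinct vertices. -/
lemma exists_adj_l1norm_sub {d : ℕ} {u v : Zd d} (h : u ≠ v) :
    ∃ w, (latticeGraph d).Adj w v ∧ l1norm (u - w) = l1norm (u - v) - 1 := by
  obtain ⟨i, hi⟩ := Function.ne_iff.mp h
  obtain ⟨s, hs, hs'⟩ : ∃ s : ℤ, |s| = 1 ∧ |u i - v i - s| = |u i - v i| - 1 := by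
    rcases lt_or_gt_of_ne hi with hlt | hlt
    · refine ⟨-1, by simp, ?_⟩
      rw [abs_of_nonpos (by omega), abs_of_neg (by omega)]
      ring
    · refine ⟨1, by simp, ?_⟩
      rw [abs_of_nonneg (by omega), abs_of_pos (by omega)]
  refine ⟨v + Pi.single i s, ?_, ?_⟩
  · change l1norm _ = 1
    rw [add_sub_cancel_left, l1norm, Finset.sum_eq_single i]
    · simpa using hs
    · intro j _ hj
      simp [hj]
    · simp
  · rw [l1norm, l1norm, ← Finset.add_sum_erase _ _ (Finset.mem_univ i),
      ← Finset.add_sum_erase _ (fun j => |(u - v) j|) (Finset.mem_univ i)]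
    have : ∑ j ∈ Finset.univ.erase i, |(u - (v + Pi.single i s : Zd d)) j| =
        ∑ j ∈ Finset.univ.erase i, |(u - v) j| :=
      Finset.sum_congr rfl fun j hj => by simp [Finset.ne_of_mem_erase hj]
    rw [this]
    simp only [Pi.sub_apply, Pi.add_apply, Pi.single_eq_same]
    rw [← sub_sub, hs']
    ring

/-! ### Height functions on the whole lattice -/

/-- Homomorphism height functions on all of `ℤ^d`, with the Lipschitz condition imposed on edges
only. -/
structure IsHom {d : ℕ} (f : Zd d → ℤ) : Prop where
  adj : ∀ u v, (latticeGraph d).Adj u v → |f u - f v| ≤ 1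
  parity : ∀ v, f v ≡ l1norm v [ZMOD 2]

lemma IsHom.lipschitz {d : ℕ} {f : Zd d → ℤ} (hf : IsHom f) (u v : Zd d) :
    |f u - f v| ≤ l1norm (u - v) := by
  obtain ⟨n, hn⟩ := Int.eq_ofNat_of_zero_le (l1norm_nonneg (u - v))
  induction n generalizing v with
  | zero =>
    by_cases h : u = v
    · subst h
      simp [l1norm]
    · obtain ⟨w, -, hw⟩ := exists_adj_l1norm_sub h
      have := l1norm_nonneg (u - w)
      omega
  | succ n ih =>
    by_cases h : u = v
    · subst h
      simp [l1norm]
    · obtain ⟨w, hwv, hw⟩ := exists_adj_l1norm_sub h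
      have h1 := ih w (by push_cast at hn; omega)
      have h2 := hf.adj w v hwv
      have h3 := abs_sub_le (f u) (f w) (f v)
      omega

lemma IsHom.isHeightFunction {d : ℕ} {f : Zd d → ℤ} (hf : IsHom f) (D : Set (Zd d)) :
    IsHeightFunction D (D.domRestrict f) :=
  ⟨fun u v => hf.lipschitz u v, fun v => hf.parity v⟩

lemma IsHeightFunction.isHom {d : ℕ} {f : Zd d → ℤ}
    (hf : IsHeightFunction Set.univ (Set.univ.domRestrict f)) : IsHom f :=
  ⟨fun u v huv => (hf.lipschitz ⟨u, trivial⟩ ⟨v, trivial⟩).trans_eq huv,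
    fun v => hf.parity ⟨v, trivial⟩⟩

open Classical in
/-- The function on `ℤ^d` that is `y` on `Λ` and `x` off `Λ`; the values of `y` on the boundary of
`Λ` are ignored. -/
def glue {d : ℕ} (Λ : Set (Zd d)) (x : ↥Λᶜ → ℤ) (y : oneExt Λ → ℤ) (v : Zd d) : ℤ :=
  if h : v ∈ Λ then y ⟨v, Or.inl h⟩ else x ⟨v, h⟩

lemma glue_domRestrict {d : ℕ} {Λ : Set (Zd d)} {f g : Zd d → ℤ} (h : ∀ v ∉ Λ, g v = f v) :
    glue Λ (Λᶜ.domRestrict f) ((oneExt Λ).domRestrict g) = g := by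
  funext v
  by_cases hv : v ∈ Λ
  · simp [glue, hv]
  · simp [glue, hv, h v hv]

lemma glue_eq_of_notMem {d : ℕ} {Λ : Set (Zd d)} (f : Zd d → ℤ) (y : oneExt Λ → ℤ) {v : Zd d}
    (hv : v ∉ Λ) : glue Λ (Λᶜ.domRestrict f) y v = f v := by
  simp [glue, hv]

lemma domRestrict_glue {d : ℕ} {Λ : Set (Zd d)} {f : Zd d → ℤ} {y : oneExt Λ → ℤ}
    (hy : y ∈ heightExtensions Λ ((extBoundary Λ).domRestrict f)) :
    (oneExt Λ).domRestrict (glue Λ (Λᶜ.domRestrict f) y) = y := by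
  funext ⟨v, hv⟩
  by_cases hvΛ : v ∈ Λ
  · simp [glue, hvΛ]
  · have hb : v ∈ extBoundary Λ := hv.resolve_left hvΛ
    rw [Set.domRestrict_apply, glue_eq_of_notMem f y hvΛ]
    exact (hy.2 v hb).symm

lemma isHom_glue {d : ℕ} {Λ : Set (Zd d)} {f : Zd d → ℤ} (hf : IsHom f) {y : oneExt Λ → ℤ}
    (hy : y ∈ heightExtensions Λ ((extBoundary Λ).domRestrict f)) :
    IsHom (glue Λ (Λᶜ.domRestrict f) y) := by
  have hin : ∀ v (hv : v ∈ oneExt Λ), glue Λ (Λᶜ.domRestrict f) y v = y ⟨v, hv⟩ := fun v hv =>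
    congrFun (domRestrict_glue hy) ⟨v, hv⟩
  -- Every edge lies inside `Λ⁺` or inside the complement of `Λ`.
  have hmem : ∀ u ∈ Λ, ∀ v, (latticeGraph d).Adj u v → v ∈ oneExt Λ := fun u hu v huv =>
    (em (v ∈ Λ)).imp id fun hv => ⟨hv, u, hu, huv⟩
  have hΛ : ∀ u ∈ oneExt Λ, ∀ v ∈ oneExt Λ, (latticeGraph d).Adj u v →
      |glue Λ (Λᶜ.domRestrict f) y u - glue Λ (Λᶜ.domRestrict f) y v| ≤ 1 := by
    intro u hu v hv huv
    rw [hin u hu, hin v hv]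
    exact (hy.1.lipschitz ⟨u, hu⟩ ⟨v, hv⟩).trans_eq huv
  refine ⟨fun u v huv => ?_, fun v => ?_⟩
  · by_cases hu : u ∈ Λ
    · exact hΛ u (Or.inl hu) v (hmem u hu v huv) huv
    by_cases hv : v ∈ Λ
    · exact hΛ u (hmem v hv u huv.symm) v (Or.inl hv) huv
    rw [glue_eq_of_notMem f y hu, glue_eq_of_notMem f y hv]
    exact hf.adj u v huv
  · by_cases hv : v ∈ Λ
    · rw [hin v (Or.inl hv)]
      exact hy.1.parity ⟨v, Or.inl hv⟩
    · rw [glue_eq_of_notMem f y hv]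
      exact hf.parity v

lemma IsHom.domRestrict_mem_heightExtensions {d : ℕ} {Λ : Set (Zd d)} {f g : Zd d → ℤ}
    (hg : IsHom g) (h : ∀ v ∉ Λ, g v = f v) :
    (oneExt Λ).domRestrict g ∈ heightExtensions Λ ((extBoundary Λ).domRestrict f) :=
  ⟨hg.isHeightFunction _, fun v hv => h v hv.1⟩

/-- Gluing of pairs of functions, componentwise. -/
def gluePair {d : ℕ} (Λ : Set (Zd d)) (x : (↥Λᶜ → ℤ) × (↥Λᶜ → ℤ))
    (y : (oneExt Λ → ℤ) × (oneExt Λ → ℤ)) : (Zd d → ℤ) × (Zd d → ℤ) :=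
  (glue Λ x.1 y.1, glue Λ x.2 y.2)

lemma measurable_gluePair {d : ℕ} (Λ : Set (Zd d)) :
    Measurable fun q : ((↥Λᶜ → ℤ) × (↥Λᶜ → ℤ)) × ((oneExt Λ → ℤ) × (oneExt Λ → ℤ)) =>
      gluePair Λ q.1 q.2 := by
  refine Measurable.prodMk (measurable_pi_lambda _ fun v => ?_) (measurable_pi_lambda _ fun v => ?_)
  all_goals
    by_cases hv : v ∈ Λ
    · simp only [glue, hv, dite_true]
      fun_prop
    · simp only [glue, hv, dite_false]
      fun_prop

lemma measurable_restrictPair {d : ℕ} (D : Set (Zd d)) : Measurable (restrictPair D) :=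
  Measurable.prodMk
    (measurable_pi_lambda _ fun v => (measurable_pi_apply v.1).comp measurable_fst)
    (measurable_pi_lambda _ fun v => (measurable_pi_apply v.1).comp measurable_snd)

/-! ### Exchanging two functions on insulated regions -/

/-- The union of all finite subsets of `Λ` on whose external boundary the two functions of the pair
agree. -/
def swapRegion {d : ℕ} (Λ : Set (Zd d)) (p : (Zd d → ℤ) × (Zd d → ℤ)) : Set (Zd d) :=
  {v | ∃ C : Finset (Zd d), ↑C ⊆ Λ ∧ (∀ w ∈ extBoundary (C : Set (Zd d)), p.1 w = p.2 w) ∧ v ∈ C}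

open Classical in
/-- The pair obtained by exchanging its two functions on `swapRegion Λ p`. -/
def exchange {d : ℕ} (Λ : Set (Zd d)) (p : (Zd d → ℤ) × (Zd d → ℤ)) :
    (Zd d → ℤ) × (Zd d → ℤ) :=
  ((swapRegion Λ p).piecewise p.2 p.1, (swapRegion Λ p).piecewise p.1 p.2)

section Exchange

variable {d : ℕ} {Λ : Set (Zd d)} {p : (Zd d → ℤ) × (Zd d → ℤ)}

lemma swapRegion_subset : swapRegion Λ p ⊆ Λ := fun _ ⟨_, hC, _, hv⟩ => hC hv

lemma swapRegion_mono {Λ' : Set (Zd d)} (h : Λ ⊆ Λ') : swapRegion Λ p ⊆ swapRegion Λ' p :=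
  fun _ ⟨C, hC, hCp, hv⟩ => ⟨C, hC.trans h, hCp, hv⟩

lemma eq_of_mem_extBoundary_swapRegion {w : Zd d} (hw : w ∈ extBoundary (swapRegion Λ p)) :
    p.1 w = p.2 w := by
  obtain ⟨hw, v, ⟨C, hC, hCp, hv⟩, hvw⟩ := hw
  exact hCp w ⟨fun h => hw ⟨C, hC, hCp, h⟩, v, hv, hvw⟩

lemma exchange_of_mem {v : Zd d} (hv : v ∈ swapRegion Λ p) :
    (exchange Λ p).1 v = p.2 v ∧ (exchange Λ p).2 v = p.1 v := by
  simp [exchange, hv]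

lemma exchange_of_notMem {v : Zd d} (hv : v ∉ swapRegion Λ p) :
    (exchange Λ p).1 v = p.1 v ∧ (exchange Λ p).2 v = p.2 v := by
  simp [exchange, hv]

lemma swapRegion_exchange : swapRegion Λ (exchange Λ p) = swapRegion Λ p := by
  -- The region depends on the pair only through its set of agreement, which is unchanged.
  have h : ∀ w, (exchange Λ p).1 w = (exchange Λ p).2 w ↔ p.1 w = p.2 w := by
    intro w
    by_cases hw : w ∈ swapRegion Λ p
    · rw [(exchange_of_mem hw).1, (exchange_of_mem hw).2, eq_comm]
    · rw [(exchange_of_notMem hw).1, (exchange_of_notMem hw).2]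
  simp only [swapRegion, h]

lemma exchange_exchange : exchange Λ (exchange Λ p) = p := by
  ext v
  all_goals
    by_cases hv : v ∈ swapRegion Λ p
    · have hv' : v ∈ swapRegion Λ (exchange Λ p) := by rwa [swapRegion_exchange]
      simp only [exchange_of_mem hv, exchange_of_mem hv']
    · have hv' : v ∉ swapRegion Λ (exchange Λ p) := by rwa [swapRegion_exchange]
      simp only [exchange_of_notMem hv, exchange_of_notMem hv']

lemma isHom_piecewise {U : Set (Zd d)} [∀ v, Decidable (v ∈ U)] {f g : Zd d → ℤ} (hf : IsHom f)
    (hg : IsHom g) (h : ∀ w ∈ extBoundary U, f w = g w) : IsHom (U.piecewise g f) := by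
  have hmixed : ∀ u ∈ U, ∀ v ∉ U, (latticeGraph d).Adj u v → |g u - f v| ≤ 1 := by
    intro u hu v hv huv
    rw [h v ⟨hv, u, hu, huv⟩]
    exact hg.adj u v huv
  refine ⟨fun u v huv => ?_, fun v => ?_⟩
  · by_cases hu : u ∈ U <;> by_cases hv : v ∈ U <;> simp only [Set.piecewise, hu, hv, if_true,
      if_false]
    · exact hg.adj u v huv
    · exact hmixed u hu v hv huv
    · rw [abs_sub_comm]
      exact hmixed v hv u hu huv.symm
    · exact hf.adj u v huv
  · by_cases hv : v ∈ U <;> simp only [Set.piecewise, hv, if_true, if_false]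
    · exact hg.parity v
    · exact hf.parity v

lemma isHom_exchange (hp : IsHom p.1 ∧ IsHom p.2) :
    IsHom (exchange Λ p).1 ∧ IsHom (exchange Λ p).2 := by
  classical
  exact ⟨isHom_piecewise hp.1 hp.2 fun _ => eq_of_mem_extBoundary_swapRegion,
    isHom_piecewise hp.2 hp.1 fun _ hw => (eq_of_mem_extBoundary_swapRegion hw).symm⟩

lemma measurableSet_mem_swapRegion (Λ : Set (Zd d)) (v : Zd d) :
    MeasurableSet {p : (Zd d → ℤ) × (Zd d → ℤ) | v ∈ swapRegion Λ p} := by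
  have h : {p : (Zd d → ℤ) × (Zd d → ℤ) | v ∈ swapRegion Λ p} =
      ⋃ C ∈ {C : Finset (Zd d) | ↑C ⊆ Λ ∧ v ∈ C}, ⋂ w ∈ extBoundary (C : Set (Zd d)),
        {p | p.1 w = p.2 w} := by
    ext p
    simp only [swapRegion, Set.mem_ofPred_eq, Set.mem_iUnion, Set.mem_iInter, exists_prop]
    exact exists_congr fun C => by tauto
  rw [h]
  exact .biUnion (Set.to_countable _) fun C _ => .biInter (Set.to_countable _) fun w _ =>
    measurableSet_eq_fun (by fun_prop) (by fun_prop)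

lemma measurable_exchange (Λ : Set (Zd d)) : Measurable (exchange Λ) := by
  classical
  refine Measurable.prodMk (measurable_pi_lambda _ fun v => ?_) (measurable_pi_lambda _ fun v => ?_)
  · exact Measurable.ite (measurableSet_mem_swapRegion Λ v)
      ((measurable_pi_apply v).comp measurable_snd) ((measurable_pi_apply v).comp measurable_fst)
  · exact Measurable.ite (measurableSet_mem_swapRegion Λ v)
      ((measurable_pi_apply v).comp measurable_fst) ((measurable_pi_apply v).comp measurable_snd)

end Exchange

/-! ### Invariance of Gibbs pairs under exchange in a finite volume -/

lemma uniformOn_prod_uniformOn {α β : Type*} [MeasurableSpace α] [MeasurableSpace β] [Countable α]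
    [Countable β] [MeasurableSingletonClass α] [MeasurableSingletonClass β] (A : Set α)
    (B : Set β) :
    (uniformOn A).prod (uniformOn B) = ((Measure.count A)⁻¹ * (Measure.count B)⁻¹) •
      Measure.count.restrict (A ×ˢ B) := by
  refine Measure.ext_of_singleton fun ⟨a, b⟩ => ?_
  rw [← Set.singleton_prod_singleton, Measure.prod_prod, Measure.smul_apply,
    Measure.restrict_apply (Set.to_countable _).measurableSet, Set.prod_inter_prod, uniformOn,
    uniformOn, cond_apply (Set.to_countable _).measurableSet,
    cond_apply (Set.to_countable _).measurableSet, smul_eq_mul,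
    mul_mul_mul_comm, Set.inter_comm A, Set.inter_comm B]
  congr 1
  rw [Measure.count_apply (Set.to_countable _).measurableSet,
    Measure.count_apply (Set.to_countable _).measurableSet,
    Measure.count_apply (Set.to_countable _).measurableSet]
  by_cases ha : a ∈ A <;> by_cases hb : b ∈ B <;> simp [ha, hb]

lemma restrict_count_le_of_injOn {α : Type*} [MeasurableSpace α] [Countable α]
    [MeasurableSingletonClass α] {H S S' : Set α} (e : α → α) (he : Set.MapsTo e (S ∩ H) (S' ∩ H))
    (hinj : Set.InjOn e (S ∩ H)) :
    (Measure.count : Measure α).restrict H S ≤ (Measure.count : Measure α).restrict H S' := by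
  rw [Measure.restrict_apply (Set.to_countable _).measurableSet,
    Measure.restrict_apply (Set.to_countable _).measurableSet,
    Measure.count_apply (Set.to_countable _).measurableSet,
    Measure.count_apply (Set.to_countable _).measurableSet]
  exact_mod_cast Set.encard_le_encard_of_injOn he hinj

section FiniteVolume

variable {d : ℕ} {Λ : Set (Zd d)} {p : (Zd d → ℤ) × (Zd d → ℤ)}

/-- The pairs of height functions in `Λ⁺` with boundary values given by `p`. -/
def pairExtensions (Λ : Set (Zd d)) (p : (Zd d → ℤ) × (Zd d → ℤ)) :
    Set ((oneExt Λ → ℤ) × (oneExt Λ → ℤ)) :=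
  heightExtensions Λ ((extBoundary Λ).domRestrict p.1) ×ˢ
    heightExtensions Λ ((extBoundary Λ).domRestrict p.2)

/-- Exchange acts on the pairs of height functions in `Λ⁺` with boundary values given by `p`. -/
lemma restrictPair_exchange_gluePair_mem (hp : IsHom p.1 ∧ IsHom p.2)
    {y : (oneExt Λ → ℤ) × (oneExt Λ → ℤ)} (hy : y ∈ pairExtensions Λ p) :
    restrictPair (oneExt Λ) (exchange Λ (gluePair Λ (restrictPair Λᶜ p) y)) ∈
        pairExtensions Λ p ∧
      gluePair Λ (restrictPair Λᶜ p)
          (restrictPair (oneExt Λ) (exchange Λ (gluePair Λ (restrictPair Λᶜ p) y))) =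
        exchange Λ (gluePair Λ (restrictPair Λᶜ p) y) := by
  set q := gluePair Λ (restrictPair Λᶜ p) y with hq
  have hqhom : IsHom q.1 ∧ IsHom q.2 := ⟨isHom_glue hp.1 hy.1, isHom_glue hp.2 hy.2⟩
  have hex := isHom_exchange (Λ := Λ) hqhom
  have hout : ∀ v ∉ Λ, (exchange Λ q).1 v = p.1 v ∧ (exchange Λ q).2 v = p.2 v := by
    intro v hv
    have hv' : v ∉ swapRegion Λ q := fun h => hv (swapRegion_subset h)
    rw [(exchange_of_notMem hv').1, (exchange_of_notMem hv').2]
    exact ⟨glue_eq_of_notMem p.1 y.1 hv, glue_eq_of_notMem p.2 y.2 hv⟩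
  exact ⟨⟨hex.1.domRestrict_mem_heightExtensions fun v hv => (hout v hv).1,
    hex.2.domRestrict_mem_heightExtensions fun v hv => (hout v hv).2⟩,
    Prod.ext (glue_domRestrict fun v hv => (hout v hv).1)
      (glue_domRestrict fun v hv => (hout v hv).2)⟩

lemma restrict_count_exchange_le (hΛ : Λ.Finite) (hp : IsHom p.1 ∧ IsHom p.2)
    (A : Set ((Zd d → ℤ) × (Zd d → ℤ))) :
    Measure.count.restrict (pairExtensions Λ p)
        {y | exchange Λ (gluePair Λ (restrictPair Λᶜ p) y) ∈ A} ≤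
      Measure.count.restrict (pairExtensions Λ p)
        {y | gluePair Λ (restrictPair Λᶜ p) y ∈ A} := by
  have := hΛ.oneExt.to_subtype
  refine restrict_count_le_of_injOn
    (fun y => restrictPair (oneExt Λ) (exchange Λ (gluePair Λ (restrictPair Λᶜ p) y))) ?_ ?_
  · rintro y ⟨hyA, hy⟩
    obtain ⟨h1, h2⟩ := restrictPair_exchange_gluePair_mem hp hy
    refine ⟨?_, h1⟩
    rw [Set.mem_ofPred_eq, h2]
    exact hyA
  · rintro y ⟨-, hy⟩ z ⟨-, hz⟩ hyz
    have h := congrArg (gluePair Λ (restrictPair Λᶜ p)) hyz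
    simp only [(restrictPair_exchange_gluePair_mem hp hy).2,
      (restrictPair_exchange_gluePair_mem hp hz).2] at h
    have h' := congrArg (fun q => restrictPair (oneExt Λ) (exchange Λ q)) h
    simp only [exchange_exchange] at h'
    have hrestrict : ∀ x ∈ pairExtensions Λ p,
        restrictPair (oneExt Λ) (gluePair Λ (restrictPair Λᶜ p) x) = x := fun x hx =>
      Prod.ext (domRestrict_glue hx.1) (domRestrict_glue hx.2)
    rwa [hrestrict y hy, hrestrict z hz] at h'

/-- The finite-volume Gibbs measures for pairs are invariant under exchange. -/
lemma finiteGibbs_prod_exchange (hΛ : Λ.Finite) (hp : IsHom p.1 ∧ IsHom p.2)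
    (A : Set ((Zd d → ℤ) × (Zd d → ℤ))) :
    ((finiteGibbs Λ ((extBoundary Λ).domRestrict p.1)).prod
        (finiteGibbs Λ ((extBoundary Λ).domRestrict p.2)))
        {y | exchange Λ (gluePair Λ (restrictPair Λᶜ p) y) ∈ A} =
      ((finiteGibbs Λ ((extBoundary Λ).domRestrict p.1)).prod
        (finiteGibbs Λ ((extBoundary Λ).domRestrict p.2)))
        {y | gluePair Λ (restrictPair Λᶜ p) y ∈ A} := by
  have := hΛ.oneExt.to_subtype
  rw [finiteGibbs, finiteGibbs, uniformOn_prod_uniformOn, Measure.smul_apply, Measure.smul_apply]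
  congr 1
  refine le_antisymm (restrict_count_exchange_le hΛ hp A) ?_
  -- The reverse inequality is the same one for the preimage of `A`, exchange being an involution.
  have h := restrict_count_exchange_le hΛ hp (exchange Λ ⁻¹' A)
  simpa only [Set.mem_preimage, exchange_exchange, pairExtensions] using h

end FiniteVolume

section Gibbs

variable {d : ℕ} {ρ : Measure ((Zd d → ℤ) × (Zd d → ℤ))} [IsProbabilityMeasure ρ]

lemma IsGibbsPair.ae_isHom (hρ : IsGibbsPair ρ) : ∀ᵐ p ∂ρ, IsHom p.1 ∧ IsHom p.2 := by
  filter_upwards [hρ.isHeightFunction] with p hp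
  exact ⟨hp.1.isHom, hp.2.isHom⟩

/-- A Gibbs pair is recovered by resampling inside `Λ` from its finite-volume Gibbs measure. -/
lemma IsGibbsPair.apply_eq_lintegral (hρ : IsGibbsPair ρ) {Λ : Set (Zd d)} (hΛ : Λ.Finite)
    (hne : Λ.Nonempty) {A : Set ((Zd d → ℤ) × (Zd d → ℤ))} (hA : MeasurableSet A) :
    ρ A = ∫⁻ p, ((finiteGibbs Λ ((extBoundary Λ).domRestrict p.1)).prod
      (finiteGibbs Λ ((extBoundary Λ).domRestrict p.2)))
      {y | gluePair Λ (restrictPair Λᶜ p) y ∈ A} ∂ρ := by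
  have hX := measurable_restrictPair Λᶜ
  have hY := measurable_restrictPair (oneExt Λ)
  have hB := measurable_gluePair Λ hA
  have hglue : ∀ p : (Zd d → ℤ) × (Zd d → ℤ),
      gluePair Λ (restrictPair Λᶜ p) (restrictPair (oneExt Λ) p) = p := fun p =>
    Prod.ext (glue_domRestrict fun _ _ => rfl) (glue_domRestrict fun _ _ => rfl)
  have h := congrArg (fun μ : Measure (((↥Λᶜ → ℤ) × (↥Λᶜ → ℤ)) ×
    ((oneExt Λ → ℤ) × (oneExt Λ → ℤ))) => μ ((fun q : ((↥Λᶜ → ℤ) × (↥Λᶜ → ℤ)) ×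
    ((oneExt Λ → ℤ) × (oneExt Λ → ℤ)) => gluePair Λ q.1 q.2) ⁻¹' A))
    (compProd_map_condDistrib (X := restrictPair Λᶜ) (μ := ρ) hY.aemeasurable)
  simp only [Measure.map_apply (hX.prodMk hY) hB, Measure.compProd_apply hB] at h
  rw [lintegral_map (Kernel.measurable_kernel_prodMk_left hB) hX] at h
  simp only [Set.preimage, Set.mem_ofPred_eq, hglue, Set.ofPred_mem_eq] at h
  rw [← h]
  refine lintegral_congr_ae ?_
  filter_upwards [hρ.condDistrib_eq Λ hΛ hne] with p hp
  rw [hp]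

lemma IsGibbsPair.map_exchange_of_finite (hρ : IsGibbsPair ρ) {Λ : Set (Zd d)} (hΛ : Λ.Finite)
    (hne : Λ.Nonempty) : ρ.map (exchange Λ) = ρ := by
  ext A hA
  rw [Measure.map_apply (measurable_exchange Λ) hA,
    hρ.apply_eq_lintegral hΛ hne (measurable_exchange Λ hA), hρ.apply_eq_lintegral hΛ hne hA]
  refine lintegral_congr_ae ?_
  filter_upwards [hρ.ae_isHom] with p hp
  exact finiteGibbs_prod_exchange hΛ hp A

/-! ### Invariance under exchange in infinite volume -/

/-- Each vertex is swapped by all large boxes or by none, so the exchanges in boxes converge. -/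
lemma tendsto_exchange_Icc (p : (Zd d → ℤ) × (Zd d → ℤ)) :
    Filter.Tendsto (fun n : ℕ => exchange (Set.Icc (fun _ => -(n : ℤ)) (fun _ => (n : ℤ))) p)
      Filter.atTop (nhds (exchange Set.univ p)) := by
  have key : ∀ v, ∀ᶠ n : ℕ in Filter.atTop,
      (v ∈ swapRegion (Set.Icc (fun _ => -(n : ℤ)) (fun _ => (n : ℤ))) p ↔
        v ∈ swapRegion Set.univ p) := by
    intro v
    by_cases hv : v ∈ swapRegion Set.univ p
    · obtain ⟨C, -, hCp, hvC⟩ := hv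
      have hbox : ∀ᶠ n : ℕ in Filter.atTop, ∀ w ∈ C,
          w ∈ Set.Icc (fun _ => -(n : ℤ)) (fun _ => (n : ℤ)) := by
        refine (Filter.eventually_all_finset C).mpr fun w _ => ?_
        filter_upwards [Filter.eventually_ge_atTop (l1norm w).toNat] with n hn
        have hle : ∀ i, |w i| ≤ (n : ℤ) := fun i =>
          (abs_le_l1norm w i).trans (Int.toNat_le.mp hn)
        exact ⟨fun i => (abs_le.mp (hle i)).1, fun i => (abs_le.mp (hle i)).2⟩
      filter_upwards [hbox] with n hn
      exact iff_of_true ⟨C, hn, hCp, hvC⟩ ⟨C, Set.subset_univ _, hCp, hvC⟩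
    · exact Filter.Eventually.of_forall fun n =>
        iff_of_false (fun h => hv (swapRegion_mono (Set.subset_univ _) h)) hv
  refine Filter.Tendsto.prodMk_nhds (tendsto_pi_nhds.mpr fun v => ?_)
    (tendsto_pi_nhds.mpr fun v => ?_)
  all_goals
    refine tendsto_nhds_of_eventually_eq ?_
    filter_upwards [key v] with n hn
    by_cases hv : v ∈ swapRegion Set.univ p <;> simp [Set.piecewise, hn, hv]

lemma IsGibbsPair.map_exchange_univ (hρ : IsGibbsPair ρ) : ρ.map (exchange Set.univ) = ρ := by
  have := Measure.isProbabilityMeasure_map (μ := ρ)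
    (measurable_exchange (d := d) Set.univ).aemeasurable
  refine ext_of_forall_integral_eq_of_IsFiniteMeasure fun φ => ?_
  have hφ : Measurable φ := φ.continuous.measurable
  rw [integral_map (measurable_exchange _).aemeasurable hφ.aestronglyMeasurable]
  set Λ : ℕ → Set (Zd d) := fun n => Set.Icc (fun _ => -(n : ℤ)) (fun _ => (n : ℤ))
  have hlim : Filter.Tendsto (fun n => ∫ p, φ (exchange (Λ n) p) ∂ρ) Filter.atTop
      (nhds (∫ p, φ (exchange Set.univ p) ∂ρ)) := by
    refine tendsto_integral_of_dominated_convergence (fun _ => ‖φ‖)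
      (fun n => (hφ.comp (measurable_exchange _)).aestronglyMeasurable) (integrable_const _)
      (fun n => Filter.Eventually.of_forall fun p => φ.norm_coe_le_norm _)
      (Filter.Eventually.of_forall fun p => ?_)
    exact (φ.continuous.tendsto _).comp (tendsto_exchange_Icc p)
  have hconst : ∀ n, ∫ p, φ (exchange (Λ n) p) ∂ρ = ∫ p, φ p ∂ρ := by
    intro n
    rw [← integral_map (measurable_exchange _).aemeasurable hφ.aestronglyMeasurable,
      hρ.map_exchange_of_finite (Set.finite_Icc _ _) ⟨0, by constructor <;> intro i <;> simp⟩]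
  simp only [hconst] at hlim
  exact tendsto_nhds_unique hlim tendsto_const_nhds

/-- The first function keeps its law after exchange. -/
lemma IsGibbsPair.map_fst_eq (hρ : IsGibbsPair ρ) :
    ρ.map Prod.fst = ρ.map fun p => (exchange Set.univ p).1 := by
  conv_lhs => rw [← hρ.map_exchange_univ]
  exact Measure.map_map measurable_fst (measurable_exchange _)

end Gibbs

/-! ### Clusters of disagreement -/

/-- The boundary of a component of `S` is contained in the boundary of `S`, so a finite component
is exchanged as soon as the two functions agree on the boundary of `S`. -/
lemma subset_swapRegion_univ {d : ℕ} {p : (Zd d → ℤ) × (Zd d → ℤ)} {S : Set (Zd d)}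
    (hS : ¬ HasInfiniteComponent S) (hp : ∀ w ∈ extBoundary S, p.1 w = p.2 w) :
    S ⊆ swapRegion Set.univ p := by
  intro v hv
  set K := ((latticeGraph d).induce S).connectedComponentMk ⟨v, hv⟩
  have hK : K.supp.Finite := by
    by_contra h
    exact hS ⟨K, h⟩
  refine ⟨(hK.image Subtype.val).toFinset, Set.subset_univ _, ?_, ?_⟩
  · rw [Set.Finite.coe_toFinset]
    rintro w ⟨hw, _, ⟨u, hu, rfl⟩, huw⟩
    -- A neighbour of the component that lay in `S` would belong to the component.
    refine hp w ⟨fun hwS => hw ⟨⟨w, hwS⟩, ?_, rfl⟩, u, u.2, huw⟩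
    exact (SimpleGraph.ConnectedComponent.mem_supp_congr_adj K
      (show ((latticeGraph d).induce S).Adj u ⟨w, hwS⟩ from huw)).mp hu
  · rw [Set.Finite.mem_toFinset]
    exact ⟨⟨v, hv⟩, rfl, rfl⟩

/-- Height functions have equal parities, so they cannot cross without meeting. -/
lemma IsHom.eq_of_mem_extBoundary_lt {d : ℕ} {f g : Zd d → ℤ} (hf : IsHom f) (hg : IsHom g)
    {w : Zd d} (hw : w ∈ extBoundary {v | f v < g v}) : f w = g w := by
  obtain ⟨hw, u, hu, huw⟩ := hw
  have h1 := abs_le.mp (hf.adj u w huw)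
  have h2 := abs_le.mp (hg.adj u w huw)
  have h3 : f u % 2 = g u % 2 := (hf.parity u).trans (hg.parity u).symm
  have h4 : f w % 2 = g w % 2 := (hf.parity w).trans (hg.parity w).symm
  simp only [Set.mem_ofPred_eq, not_lt] at hw hu
  omega

theorem mainTheorem6 {d : ℕ} (hd : 1 ≤ d) (ρ : Measure ((Zd d → ℤ) × (Zd d → ℤ)))
    [IsProbabilityMeasure ρ] (hρ : IsGibbsPair ρ) :
    (ρ {p | HasInfiniteComponent {v | p.1 v < p.2 v}} = 0 →
      StochDominates (ρ.map Prod.fst) (ρ.map Prod.snd)) ∧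
    (ρ {p | HasInfiniteComponent {v | p.1 v ≠ p.2 v}} = 0 →
      ρ.map Prod.fst = ρ.map Prod.snd) := by
  have hmeas : Measurable fun p : (Zd d → ℤ) × (Zd d → ℤ) => (exchange Set.univ p).1 :=
    measurable_fst.comp (measurable_exchange _)
  refine ⟨fun h φ hφ hmono ⟨M, hM⟩ => ?_, fun h => ?_⟩
  · have hint : ∀ F : (Zd d → ℤ) × (Zd d → ℤ) → Zd d → ℤ, Measurable F →
        Integrable (fun p => φ (F p)) ρ := fun F hF =>
      (integrable_const M).mono' (hφ.comp hF).aestronglyMeasurable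
        (Filter.Eventually.of_forall fun p => hM _)
    rw [hρ.map_fst_eq, integral_map hmeas.aemeasurable hφ.aestronglyMeasurable,
      integral_map measurable_snd.aemeasurable hφ.aestronglyMeasurable]
    refine integral_mono_ae (hint _ measurable_snd) (hint _ hmeas) ?_
    filter_upwards [measure_eq_zero_iff_ae_notMem.mp h, hρ.ae_isHom] with p hp hhom
    refine hmono fun v => ?_
    by_cases hv : v ∈ swapRegion Set.univ p
    · exact (exchange_of_mem hv).1.ge
    · rw [(exchange_of_notMem hv).1]
      by_contra! hlt
      exact hv (subset_swapRegion_univ hp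
        (fun w hw => hhom.1.eq_of_mem_extBoundary_lt hhom.2 hw) hlt)
  · rw [hρ.map_fst_eq]
    refine Measure.map_congr ?_
    filter_upwards [measure_eq_zero_iff_ae_notMem.mp h] with p hp
    funext v
    by_cases hv : v ∈ swapRegion Set.univ p
    · exact (exchange_of_mem hv).1
    · rw [(exchange_of_notMem hv).1]
      by_contra hne
      exact hv (subset_swapRegion_univ hp (fun w hw => not_not.mp hw.1) hne)

end
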